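/- Consider a receiver with $N_r$ antennas and a reflecting surface with $N$ elements. The channel coefficients $h_{l,i}$ ($1\le l\le N_r$, $1\le i\le N$) are i.i.d. $\mathcal{CN}(0,1)$; the noise $n_l$ at antenna $l$ is $\mathcal{CN}(0,N_0)$ with $N_0>0$, and the noise vector is independent of the channel; $E_s>0$ is the symbol energy. Here $\mathcal{CN}(0,v)$ is the law of a complex variable with independent $\mathcal N(0,v/2)$ real and imaginary parts, and superscripts $\mathcal R,\mathcal I$ denote real and imaginary parts. Let $m,n$ be the antennas selected for the real and imaginary part and let $\hat m$ be a competing antenna, with $m\ne n$, $\hat m\neq n$ and $\hat m\ne m$. Put $$A_i=h_{m,i}^{\mathcal R},\quad B_i=h_{n,i}^{\mathcal I},\quad C_i=-h_{m,i}^{\mathcal I},\quad D_i=h_{n,i}^{\mathcal R},\quad \hat A_i=h_{\hat m,i}^{\mathcal R},\quad \hat C_i=-h_{\hat m,i}^{\mathcal I},$$ and, with $\lambda_1=\tfrac12$, $$\theta_i^{\mathcal R}=\frac{\lambda_1A_i+(1-\lambda_1)B_i}{r_i},\quad \theta_i^{\mathcal I}=\frac{\lambda_1C_i+(1-\lambda_1)D_i}{r_i},\quad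 r_i=\sqrt{(\lambda_1A_i+(1-\lambda_1)B_i)^2+(\lambda_1C_i+(1-\lambda_1)D_i)^2}.$$ Let $$Y_i=\frac{A_i^2+C_i^2+A_iB_i+C_iD_i}{\sqrt{(A_i+B_i)^2+(C_i+D_i)^2}},\qquad \hat Y_i=\hat A_i\theta_i^{\mathcal R}+\hat C_i\theta_i^{\mathcal I},$$ $$Z_1=\sqrt{E_s}\sum_{i=1}^NY_i+n_m^{\mathcal R},\qquad Z_2=\sqrt{E_s}\sum_{i=1}^N\hat Y_i+n_{\hat m}^{\mathcal R}.$$ Then: 1. For every $N$ and $i$, $Y_i$ and $\hat Y_i$ are square-integrable, with $\mathbb E[Y_i]=\frac{\sqrt\pi}{2\sqrt2}$, $\mathbb V[Y_i]=\frac{6-\pi}{8}$, $\mathbb E[\hat Y_i]=0$, $\mathbb V[\hat Y_i]=\frac12$. 2. For every $N$, $Z_1$ is square-integrable with mean $\mu_N=\frac{N\sqrt{\pi E_s}}{2\sqrt2}$ and variance $\sigma_N^2=\frac{N(6-\pi)E_s}{8}+\frac{N_0}{2}$. 3. $Z_1$ is asymptotically $\mathcal N(\mu_N,\sigma_N^2)$: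 for each $N$ let $Z_1^{(N)}$ be the statistic $Z_1$ of such a system with $N$ elements (the systems for different $N$ may live on different probability spaces); then $(Z_1^{(N)}-\mu_N)/\sigma_N$ converges in distribution to $\mathcal N(0,1)$ as $N\to\infty$. 4. For every $N$, $Z_2$ has exactly the law $\mathcal N\left(0,\frac{NE_s}{2}+\frac{N_0}{2}\right)$. -/

import Mathlib

open MeasureTheory ProbabilityTheory Filter
open scoped NNReal

noncomputable section

namespace RIS

/-- The circularly symmetric complex normal distribution `CN(0, v)`: independent real and
imaginary parts, each normal with mean `0` and variance `v / 2`. -/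
def complexNormal (v : ℝ≥0) : Measure ℂ :=
  ((gaussianReal 0 (v / 2)).prod (gaussianReal 0 (v / 2))).map
    Complex.measurableEquivRealProd.symm

section Realization

variable {Nr N : ℕ}

/-- `A_i`: the real part of `h_{m,i}`. -/
def coefA (H : Fin Nr → Fin N → ℂ) (m : Fin Nr) (i : Fin N) : ℝ := (H m i).re

/-- `B_i`: the imaginary part of `h_{n,i}`. -/
def coefB (H : Fin Nr → Fin N → ℂ) (n : Fin Nr) (i : Fin N) : ℝ := (H n i).im

/-- `C_i`: minus the imaginary part of `h_{m,i}`. -/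
def coefC (H : Fin Nr → Fin N → ℂ) (m : Fin Nr) (i : Fin N) : ℝ := -(H m i).im

/-- `D_i`: the real part of `h_{n,i}`. -/
def coefD (H : Fin Nr → Fin N → ℂ) (n : Fin Nr) (i : Fin N) : ℝ := (H n i).re

/-- The modulus `√((λ₁ A_i + (1 - λ₁) B_i)² + (λ₁ C_i + (1 - λ₁) D_i)²)`. -/
def phaseModulus (lam : ℝ) (H : Fin Nr → Fin N → ℂ) (m n : Fin Nr) (i : Fin N) : ℝ :=
  Real.sqrt ((lam * coefA H m i + (1 - lam) * coefB H n i) ^ 2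
    + (lam * coefC H m i + (1 - lam) * coefD H n i) ^ 2)

/-- Real part of the reflection coefficient of element `i`, when antennas `m` (real part) and
`n` (imaginary part) are selected and the multiplier is `λ₁ = lam`. -/
def thetaRe (lam : ℝ) (H : Fin Nr → Fin N → ℂ) (m n : Fin Nr) (i : Fin N) : ℝ :=
  (lam * coefA H m i + (1 - lam) * coefB H n i) / phaseModulus lam H m n i

/-- Imaginary part of the reflection coefficient of element `i`. -/
def thetaIm (lam : ℝ) (H : Fin Nr → Fin N → ℂ) (m n : Fin Nr) (i : Fin N) : ℝ :=
  (lam * coefC H m i + (1 - lam) * coefD H n i) / phaseModulus lam H m n i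

/-- `Y_i = (A_i² + C_i² + A_i B_i + C_i D_i) / √((A_i + B_i)² + (C_i + D_i)²)`. -/
def elemY (H : Fin Nr → Fin N → ℂ) (m n : Fin Nr) (i : Fin N) : ℝ :=
  (coefA H m i ^ 2 + coefC H m i ^ 2 + coefA H m i * coefB H n i + coefC H m i * coefD H n i)
    / Real.sqrt ((coefA H m i + coefB H n i) ^ 2 + (coefC H m i + coefD H n i) ^ 2)

/-- `Ŷ_i = Â_i θ_i^R + Ĉ_i θ_i^I` with the phases built with `λ₁ = 1/2`; here `Â_i`, `Ĉ_i` are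
`A_i`, `C_i` for the competing antenna `mhat` in place of `m`. -/
def elemYhat (H : Fin Nr → Fin N → ℂ) (m n mhat : Fin Nr) (i : Fin N) : ℝ :=
  coefA H mhat i * thetaRe (1 / 2) H m n i + coefC H mhat i * thetaIm (1 / 2) H m n i

/-- `Z₁ = √E_s ∑ Y_i + n_m^R`, where `w` is the noise vector. -/
def statZ1 (Es : ℝ) (H : Fin Nr → Fin N → ℂ) (w : Fin Nr → ℂ) (m n : Fin Nr) : ℝ :=
  Real.sqrt Es * ∑ i, elemY H m n i + (w m).re

/-- `Z₂ = √E_s ∑ Ŷ_i + n_m̂^R`, where `w` is the noise vector. -/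
def statZ2 (Es : ℝ) (H : Fin Nr → Fin N → ℂ) (w : Fin Nr → ℂ) (m n mhat : Fin Nr) : ℝ :=
  Real.sqrt Es * ∑ i, elemYhat H m n mhat i + (w mhat).re

end Realization

/-- The random channel `H` (`Nr` receive antennas, `N` reflecting elements) has i.i.d. `CN(0,1)`
entries, every noise component is `CN(0, N0)`, and the noise is independent of the channel. -/
structure IsChannelModel {Ω : Type*} [MeasurableSpace Ω] (P : Measure Ω) {Nr N : ℕ}
    (H : Ω → Fin Nr → Fin N → ℂ) (w : Ω → Fin Nr → ℂ) (N0 : ℝ) : Prop where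
  measurable_channel : Measurable H
  measurable_noise : Measurable w
  channel_law : ∀ l i, HasLaw (fun ω ↦ H ω l i) (complexNormal 1) P
  channel_indep : iIndepFun (fun (p : Fin Nr × Fin N) ω ↦ H ω p.1 p.2) P
  noise_law : ∀ l, HasLaw (fun ω ↦ w ω l) (complexNormal N0.toNNReal) P
  noise_indep : IndepFun H w P

end RIS

end

/-! Put `U = (A, C)` and `V = (B, D)`: independent planar Gaussian vectors with variance `1/2` per
coordinate. Then `Y = ⟨U, S/‖S‖⟩` with `S = U + V`. Since `U = (S + D)/2` with `D = U - V`, one gets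
`Y = (R + T)/2`, where `R = ‖S‖` and `T = ⟨S/‖S‖, D⟩` (`projSum_eq`). `S` and `D` are independent
standard vectors, so `R` is Rayleigh and, by rotation invariance, `T` is `N(0,1)`
(`hasLaw_inner_direction`). Moreover `E[RT] = E⟨S, D⟩ = 0`. Hence `E Y = √(π/2)/2` and `E Y² = (2 +
0 + 1)/4`, which gives the variance `3/4 - π/8` (`moments_projSum`).

The same rotation invariance makes `Ŷ` exactly `N(0, 1/2)`: the competing vector is independent of
`(U, V)`. So `Z₂` is a sum of independent Gaussians.

For `Z₁` the `Y_i` are i.i.d. with a law that does not depend on `N`. Because the probability space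
varies with `N`, the central limit theorem is proved through characteristic functions
(`tendstoInDistribution_sum_add_gaussian`); the noise has fixed variance and disappears after
division by `σ_N → ∞`. -/

namespace RIS

/-! ### Planar Gaussian vectors: sums, differences, rotation invariance. -/

/-- The law of a pair of independent centred real Gaussian variables of variance `v`. -/
noncomputable abbrev planarGaussian (v : ℝ≥0) : Measure (ℝ × ℝ) :=
  (gaussianReal 0 v).prod (gaussianReal 0 v)

variable {Ω : Type*} [MeasurableSpace Ω] {P : Measure Ω}

lemma hasLaw_re_im {v : ℝ≥0} {X : Ω → ℂ} (hX : HasLaw X (complexNormal v) P) :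
    HasLaw (fun ω ↦ ((X ω).re, (X ω).im)) (planarGaussian (v / 2)) P := by
  refine HasLaw.comp (Y := fun z : ℂ ↦ (z.re, z.im)) ⟨by fun_prop, ?_⟩ hX
  rw [complexNormal, Measure.map_map (by fun_prop) (by fun_prop)]
  exact Measure.map_id

lemma hasLaw_re_neg_im {v : ℝ≥0} {X : Ω → ℂ} (hX : HasLaw X (complexNormal v) P) :
    HasLaw (fun ω ↦ ((X ω).re, -(X ω).im)) (planarGaussian (v / 2)) P := by
  refine HasLaw.comp (Y := Prod.map id (fun x : ℝ ↦ -x)) ⟨by fun_prop, ?_⟩ (hasLaw_re_im hX)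
  rw [← Measure.map_prod_map _ _ (by fun_prop) (by fun_prop), Measure.map_id,
    gaussianReal_map_neg, neg_zero]

lemma hasLaw_im_re {v : ℝ≥0} {X : Ω → ℂ} (hX : HasLaw X (complexNormal v) P) :
    HasLaw (fun ω ↦ ((X ω).im, (X ω).re)) (planarGaussian (v / 2)) P :=
  HasLaw.comp (Y := Prod.swap) ⟨by fun_prop, Measure.prod_swap⟩ (hasLaw_re_im hX)

lemma hasLaw_re {v : ℝ≥0} {X : Ω → ℂ} (hX : HasLaw X (complexNormal v) P) :
    HasLaw (fun ω ↦ (X ω).re) (gaussianReal 0 (v / 2)) P :=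
  measurePreserving_fst.comp_hasLaw (hasLaw_re_im hX)

lemma hasLaw_neg {v : ℝ≥0} {V : Ω → ℝ × ℝ} (hV : HasLaw V (planarGaussian v) P) :
    HasLaw (fun ω ↦ -V ω) (planarGaussian v) P := by
  refine HasLaw.comp (Y := Prod.map (fun x : ℝ ↦ -x) (fun x : ℝ ↦ -x)) ⟨by fun_prop, ?_⟩ hV
  rw [← Measure.map_prod_map _ _ (by fun_prop) (by fun_prop), gaussianReal_map_neg, neg_zero]

variable [IsProbabilityMeasure P]

lemma indepFun_fst_snd {v : ℝ≥0} {U : Ω → ℝ × ℝ} (hU : HasLaw U (planarGaussian v) P) :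
    IndepFun (fun ω ↦ (U ω).1) (fun ω ↦ (U ω).2) P :=
  (indepFun_iff_hasLaw_prodMk_prod (measurePreserving_fst.comp_hasLaw hU)
    (measurePreserving_snd.comp_hasLaw hU)).2 hU

/-- The sum is a Gaussian vector, so its coordinates are independent once their covariance vanishes;
all four terms of that covariance are zero by independence. -/
lemma hasLaw_add {v : ℝ≥0} {U V : Ω → ℝ × ℝ} (hU : HasLaw U (planarGaussian v) P)
    (hV : HasLaw V (planarGaussian v) P) (h : IndepFun U V P) :
    HasLaw (fun ω ↦ U ω + V ω) (planarGaussian (v + v)) P := by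
  have gU := hU.hasGaussianLaw
  have gV := hV.hasGaussianLaw
  have gS : HasGaussianLaw (fun ω ↦ U ω + V ω) P := (h.hasGaussianLaw gU gV).fun_add
  have h1 {W : Ω → ℝ × ℝ} (hW : HasLaw W (planarGaussian v) P) :
      P.map (fun ω ↦ (W ω).1) = gaussianReal 0 v :=
    (measurePreserving_fst.comp_hasLaw hW).map_eq
  have h2 {W : Ω → ℝ × ℝ} (hW : HasLaw W (planarGaussian v) P) :
      P.map (fun ω ↦ (W ω).2) = gaussianReal 0 v :=
    (measurePreserving_snd.comp_hasLaw hW).map_eq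
  have m1 {W : Ω → ℝ × ℝ} (hW : HasLaw W (planarGaussian v) P) :
      MemLp (fun ω ↦ (W ω).1) 2 P := (HasGaussianLaw.fst hW.hasGaussianLaw).memLp_two
  have m2 {W : Ω → ℝ × ℝ} (hW : HasLaw W (planarGaussian v) P) :
      MemLp (fun ω ↦ (W ω).2) 2 P := (HasGaussianLaw.snd hW.hasGaussianLaw).memLp_two
  have l1 : HasLaw (fun ω ↦ (U ω + V ω).1) (gaussianReal 0 (v + v)) P := by
    refine ⟨by fun_prop, ?_⟩
    have := gaussianReal_add_gaussianReal_of_indepFun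
      (h.comp measurable_fst measurable_fst) (h1 hU) (h1 hV)
    exact this.trans (by rw [add_zero])
  have l2 : HasLaw (fun ω ↦ (U ω + V ω).2) (gaussianReal 0 (v + v)) P := by
    refine ⟨by fun_prop, ?_⟩
    have := gaussianReal_add_gaussianReal_of_indepFun
      (h.comp measurable_snd measurable_snd) (h2 hU) (h2 hV)
    exact this.trans (by rw [add_zero])
  refine (indepFun_iff_hasLaw_prodMk_prod l1 l2).1 ?_
  refine HasGaussianLaw.indepFun_of_covariance_eq_zero gS ?_
  have e1 : (fun ω ↦ (U ω + V ω).1) = (fun ω ↦ (U ω).1) + fun ω ↦ (V ω).1 := rfl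
  have e2 : (fun ω ↦ (U ω + V ω).2) = (fun ω ↦ (U ω).2) + fun ω ↦ (V ω).2 := rfl
  have c12 : cov[fun ω ↦ (U ω).1, fun ω ↦ (V ω).2; P] = 0 :=
    IndepFun.covariance_eq_zero (h.comp measurable_fst measurable_snd) (m1 hU) (m2 hV)
  have c21 : cov[fun ω ↦ (V ω).1, fun ω ↦ (U ω).2; P] = 0 :=
    IndepFun.covariance_eq_zero (h.symm.comp measurable_fst measurable_snd) (m1 hV) (m2 hU)
  rw [e1, e2, covariance_add_left (m1 hU) (m1 hV) ((m2 hU).add (m2 hV)),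
    covariance_add_right (m1 hU) (m2 hU) (m2 hV), covariance_add_right (m1 hV) (m2 hU) (m2 hV),
    (indepFun_fst_snd hU).covariance_eq_zero (m1 hU) (m2 hU),
    (indepFun_fst_snd hV).covariance_eq_zero (m1 hV) (m2 hV),
    c12, c21]
  simp

/-- The sum and the difference of two independent Gaussian vectors with a common law are
independent. -/
lemma indepFun_add_sub {E : Type*} [NormedAddCommGroup E] [NormedSpace ℝ E] [MeasurableSpace E]
    [BorelSpace E] [CompleteSpace E] [SecondCountableTopology E] {μ : Measure E} [IsGaussian μ]
    {U V : Ω → E} (hU : HasLaw U μ P) (hV : HasLaw V μ P) (h : IndepFun U V P) :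
    IndepFun (fun ω ↦ U ω + V ω) (fun ω ↦ U ω - V ω) P := by
  have gU := hU.hasGaussianLaw
  have gV := hV.hasGaussianLaw
  -- `(U + V, U - V)` is a linear image of the Gaussian pair `(U, V)`, so independence reduces to
  -- zero covariance.
  have g := (h.hasGaussianLaw gU gV).map_fun
    ((ContinuousLinearMap.fst ℝ E E + ContinuousLinearMap.snd ℝ E E).prod
      (ContinuousLinearMap.fst ℝ E E - ContinuousLinearMap.snd ℝ E E))
  refine HasGaussianLaw.indepFun_of_covariance_strongDual (by simpa using! g) fun L₁ L₂ ↦ ?_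
  have mem (L : StrongDual ℝ E) {W : Ω → E} (hW : HasGaussianLaw W P) :
      MemLp (fun ω ↦ L (W ω)) 2 P := (hW.map_fun L).memLp_two
  have e1 : (L₁ ∘ fun ω ↦ U ω + V ω) = (fun ω ↦ L₁ (U ω)) + fun ω ↦ L₁ (V ω) := by
    ext; simp
  have e2 : (L₂ ∘ fun ω ↦ U ω - V ω) = (fun ω ↦ L₂ (U ω)) - fun ω ↦ L₂ (V ω) := by
    ext; simp
  have c12 : cov[fun ω ↦ L₁ (U ω), fun ω ↦ L₂ (V ω); P] = 0 :=
    IndepFun.covariance_eq_zero (h.comp L₁.measurable L₂.measurable) (mem _ gU) (mem _ gV)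
  have c21 : cov[fun ω ↦ L₁ (V ω), fun ω ↦ L₂ (U ω); P] = 0 :=
    IndepFun.covariance_eq_zero (h.symm.comp L₁.measurable L₂.measurable) (mem _ gV) (mem _ gU)
  -- The two remaining terms are the covariances of `L₁, L₂` under the common law `μ`, with opposite
  -- signs.
  rw [e1, e2, covariance_add_left (mem _ gU) (mem _ gV) ((mem _ gU).sub (mem _ gV)),
    covariance_sub_right (mem _ gU) (mem _ gU) (mem _ gV),
    covariance_sub_right (mem _ gV) (mem _ gU) (mem _ gV),
    c12, c21,
    hU.covariance_fun_comp (by fun_prop) (by fun_prop),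
    hV.covariance_fun_comp (by fun_prop) (by fun_prop)]
  simp

lemma map_unit_combination_planarGaussian (v : ℝ≥0) {c s : ℝ} (h : c ^ 2 + s ^ 2 = 1) :
    (planarGaussian v).map (fun p ↦ c * p.1 + s * p.2) = gaussianReal 0 v := by
  have e : (fun p : ℝ × ℝ ↦ c * p.1 + s * p.2)
      = (fun p : ℝ × ℝ ↦ p.1 + p.2) ∘ Prod.map (c * ·) (s * ·) := rfl
  rw [e, ← Measure.map_map (by fun_prop) (by fun_prop),
    ← Measure.map_prod_map _ _ (by fun_prop) (by fun_prop), gaussianReal_map_const_mul,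
    gaussianReal_map_const_mul]
  -- Convolution is by definition the image of the product measure under addition.
  change Measure.conv _ _ = _
  rw [gaussianReal_conv_gaussianReal]
  congr 1
  · simp
  · ext
    push_cast
    rw [← add_mul, h, one_mul]

/-- The component of a rotationally invariant Gaussian vector along an independent random
direction is Gaussian. -/
lemma hasLaw_inner_direction {v : ℝ≥0} {W Θ : Ω → ℝ × ℝ} (hW : HasLaw W (planarGaussian v) P)
    (hΘ : AEMeasurable Θ P) (hunit : ∀ᵐ ω ∂P, (Θ ω).1 ^ 2 + (Θ ω).2 ^ 2 = 1)
    (h : IndepFun Θ W P) :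
    HasLaw (fun ω ↦ (Θ ω).1 * (W ω).1 + (Θ ω).2 * (W ω).2) (gaussianReal 0 v) P := by
  have hprod := (indepFun_iff_hasLaw_prodMk_prod (μ := P.map Θ) ⟨hΘ, rfl⟩ hW).1 h
  have : IsProbabilityMeasure (P.map Θ) := Measure.isProbabilityMeasure_map hΘ
  have hunit' : ∀ᵐ θ ∂(P.map Θ), θ.1 ^ 2 + θ.2 ^ 2 = 1 :=
    (ae_map_iff hΘ (measurableSet_eq_fun (by fun_prop) (by fun_prop))).2 hunit
  refine HasLaw.comp (Y := fun q : (ℝ × ℝ) × (ℝ × ℝ) ↦ q.1.1 * q.2.1 + q.1.2 * q.2.2)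
    ⟨by fun_prop, ?_⟩ hprod
  have hmeas : Measurable fun q : (ℝ × ℝ) × (ℝ × ℝ) ↦ q.1.1 * q.2.1 + q.1.2 * q.2.2 := by
    fun_prop
  ext s hs
  rw [Measure.map_apply hmeas hs, Measure.prod_apply (hmeas hs)]
  -- Fubini: for almost every fixed direction the slice has the same Gaussian measure, so
  -- integrating over directions changes nothing.
  have : ∀ᵐ θ ∂(P.map Θ), planarGaussian v (Prod.mk θ ⁻¹'
      ((fun q : (ℝ × ℝ) × (ℝ × ℝ) ↦ q.1.1 * q.2.1 + q.1.2 * q.2.2) ⁻¹' s))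
      = gaussianReal 0 v s := by
    filter_upwards [hunit'] with θ hθ
    rw [← map_unit_combination_planarGaussian v hθ, Measure.map_apply (by fun_prop) hs]
    rfl
  rw [lintegral_congr_ae this]
  simp

end RIS

/-! ### Moments of the projection of `U` on the direction of `U + V`. -/

namespace RIS

variable {Ω : Type*} [MeasurableSpace Ω] {P : Measure Ω}

/-- The mean of the Rayleigh distribution. -/
lemma integral_norm_planarGaussian :
    ∫ p, √(p.1 ^ 2 + p.2 ^ 2) ∂(planarGaussian 1) = √(Real.pi / 2) := by
  have hd : planarGaussian 1 = (volume : Measure (ℝ × ℝ)).withDensity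
      (fun p ↦ gaussianPDF 0 1 p.1 * gaussianPDF 0 1 p.2) := by
    rw [planarGaussian, gaussianReal_of_var_ne_zero _ one_ne_zero,
      prod_withDensity (by fun_prop) (by fun_prop)]
    rfl
  -- Transferred to `ℂ`, this is the radial integral of `‖z‖ exp(-‖z‖²/2)/(2π)`, which a
  -- Gamma-function formula evaluates.
  rw [hd, integral_withDensity_eq_integral_toReal_smul
      (f := fun p : ℝ × ℝ ↦ gaussianPDF 0 1 p.1 * gaussianPDF 0 1 p.2) (by fun_prop)
    (ae_of_all _ fun p ↦ ENNReal.mul_lt_top ENNReal.ofReal_lt_top ENNReal.ofReal_lt_top),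
    ← Complex.volume_preserving_equiv_real_prod.integral_comp
      Complex.measurableEquivRealProd.measurableEmbedding]
  have key : ∀ z : ℂ, (gaussianPDF 0 1 (Complex.measurableEquivRealProd z).1
      * gaussianPDF 0 1 (Complex.measurableEquivRealProd z).2).toReal
        • √((Complex.measurableEquivRealProd z).1 ^ 2 + (Complex.measurableEquivRealProd z).2 ^ 2)
      = (2 * Real.pi)⁻¹ * (‖z‖ ^ (1 : ℝ) * Real.exp (-(1 / 2) * ‖z‖ ^ (2 : ℝ))) := by
    intro z
    have hz : ‖z‖ ^ 2 = z.re ^ 2 + z.im ^ 2 := by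
      rw [Complex.sq_norm, Complex.normSq_apply]; ring
    simp only [Complex.measurableEquivRealProd_apply, ENNReal.toReal_mul, toReal_gaussianPDF,
      gaussianPDFReal, smul_eq_mul, Real.rpow_one, Real.rpow_two, NNReal.coe_one, mul_one, sub_zero]
    rw [← hz, Real.sqrt_sq (norm_nonneg _)]
    have h2 : √(2 * Real.pi) * √(2 * Real.pi) = 2 * Real.pi :=
      Real.mul_self_sqrt (by positivity)
    calc _ = (√(2 * Real.pi) * √(2 * Real.pi))⁻¹ * (‖z‖ *
          (Real.exp (-z.re ^ 2 / 2) * Real.exp (-z.im ^ 2 / 2))) := by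
          rw [mul_inv]; ring
      _ = _ := by
          rw [h2, ← Real.exp_add, hz]
          ring_nf
  simp_rw [key]
  rw [integral_const_mul, Complex.integral_rpow_mul_exp_neg_mul_rpow (by norm_num) (by norm_num)
    (by norm_num)]
  have hG : Real.Gamma ((1 + 2) / 2) = √Real.pi / 2 := by
    rw [show ((1 : ℝ) + 2) / 2 = 1 / 2 + 1 by norm_num, Real.Gamma_add_one (by norm_num),
      Real.Gamma_one_half_eq]
    ring
  have hp : ((1 : ℝ) / 2) ^ (-((1 : ℝ) + 2) / 2) = 2 * √2 := by
    rw [one_div, Real.inv_rpow (by norm_num), ← Real.rpow_neg (by norm_num),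
      show -(-((1 : ℝ) + 2) / 2) = 1 + 1 / 2 by norm_num, Real.rpow_add (by norm_num),
      Real.rpow_one, ← Real.sqrt_eq_rpow]
  rw [hG, hp, Real.sqrt_div Real.pi_pos.le]
  have := Real.sq_sqrt (show (0 : ℝ) ≤ 2 by norm_num)
  have := Real.pi_pos
  field_simp
  linarith

/-- A nondegenerate Gaussian has no atoms, so already the first coordinate is almost surely nonzero.
-/
lemma ae_sq_add_sq_pos {v : ℝ≥0} (hv : v ≠ 0) {S : Ω → ℝ × ℝ}
    (hS : HasLaw S (planarGaussian v) P) : ∀ᵐ ω ∂P, 0 < (S ω).1 ^ 2 + (S ω).2 ^ 2 := by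
  have h1 : HasLaw (fun ω ↦ (S ω).1) (gaussianReal 0 v) P := measurePreserving_fst.comp_hasLaw hS
  have := nullSingletonClass_gaussianReal (μ := 0) hv
  have h0 : ∀ᵐ ω ∂P, (S ω).1 ≠ 0 :=
    (h1.ae_iff (p := fun x ↦ x ≠ 0) (by fun_prop)).2 (by simp [ae_iff])
  filter_upwards [h0] with ω hω
  positivity

/-- The unit vector in the direction of a vector of the plane. -/
noncomputable def direction (p : ℝ × ℝ) : ℝ × ℝ :=
  (p.1 / √(p.1 ^ 2 + p.2 ^ 2), p.2 / √(p.1 ^ 2 + p.2 ^ 2))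

@[fun_prop]
lemma measurable_direction : Measurable direction := by
  unfold direction; fun_prop

lemma direction_sq_add_sq {p : ℝ × ℝ} (hp : 0 < p.1 ^ 2 + p.2 ^ 2) :
    (direction p).1 ^ 2 + (direction p).2 ^ 2 = 1 := by
  simp only [direction, div_pow, Real.sq_sqrt hp.le]
  field_simp

/-- `⟨u, (u + v) / ‖u + v‖⟩` for two vectors of the plane. -/
noncomputable def projSum (u v : ℝ × ℝ) : ℝ :=
  u.1 * (direction (u + v)).1 + u.2 * (direction (u + v)).2

/-- Write `u` as half of `(u + v) + (u - v)`. If `u + v = 0`, both sides are zero because division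
by zero gives `direction 0 = 0`. -/
lemma projSum_eq (u v : ℝ × ℝ) : projSum u v = (√((u + v).1 ^ 2 + (u + v).2 ^ 2)
    + ((direction (u + v)).1 * (u - v).1 + (direction (u + v)).2 * (u - v).2)) / 2 := by
  simp only [projSum, direction]
  set q := (u + v).1 ^ 2 + (u + v).2 ^ 2 with hq
  have hq0 : 0 ≤ q := by positivity
  rcases hq0.eq_or_lt with h | h
  · simp [← h]
  · have hs := Real.sqrt_pos.2 h
    have h2 := Real.sq_sqrt h.le
    field_simp
    rw [h2, hq]
    simp only [Prod.fst_add, Prod.snd_add, Prod.fst_sub, Prod.snd_sub]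
    ring

lemma memLp_norm_planarGaussian (v : ℝ≥0) :
    MemLp (fun p : ℝ × ℝ ↦ √(p.1 ^ 2 + p.2 ^ 2)) 2 (planarGaussian v) := by
  have h : MemLp (id : ℝ × ℝ → ℝ × ℝ) 2 (planarGaussian v) :=
    IsGaussian.memLp_id _ _ (by norm_num)
  -- The norm on `ℝ × ℝ` is the sup norm; the factor `2` is a convenient bound for `√2`.
  refine (h.norm.const_mul 2).mono (by fun_prop) (ae_of_all _ fun p ↦ ?_)
  rw [Real.norm_of_nonneg (Real.sqrt_nonneg _), Real.norm_of_nonneg (by positivity)]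
  refine Real.sqrt_le_iff.2 ⟨by positivity, ?_⟩
  have h1 : p.1 ^ 2 ≤ ‖p‖ ^ 2 := by
    rw [← sq_abs]; exact pow_le_pow_left₀ (abs_nonneg _) (norm_fst_le p) 2
  have h2 : p.2 ^ 2 ≤ ‖p‖ ^ 2 := by
    rw [← sq_abs]; exact pow_le_pow_left₀ (abs_nonneg _) (norm_snd_le p) 2
  simp only [id]
  nlinarith

lemma direction_mul_norm (p : ℝ × ℝ) :
    √(p.1 ^ 2 + p.2 ^ 2) * (direction p).1 = p.1 ∧ √(p.1 ^ 2 + p.2 ^ 2) * (direction p).2 = p.2 := by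
  have hq0 : 0 ≤ p.1 ^ 2 + p.2 ^ 2 := by positivity
  rcases hq0.eq_or_lt with h | h
  · have h1 : p.1 = 0 := by nlinarith [sq_nonneg p.1, sq_nonneg p.2]
    have h2 : p.2 = 0 := by nlinarith [sq_nonneg p.1, sq_nonneg p.2]
    simp [direction, h1, h2]
  · have hs := (Real.sqrt_pos.2 h).ne'
    simp only [direction]
    exact ⟨mul_div_cancel₀ _ hs, mul_div_cancel₀ _ hs⟩

lemma integral_sq_of_hasLaw_gaussianReal {v : ℝ≥0} {X : Ω → ℝ}
    (hX : HasLaw X (gaussianReal 0 v) P) :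
    ∫ ω, X ω ^ 2 ∂P = v := by
  have h := hX.variance_eq
  rw [variance_id_gaussianReal, variance_of_integral_eq_zero hX.aemeasurable
    (by rw [hX.integral_eq, integral_id_gaussianReal])] at h
  exact h

variable [IsProbabilityMeasure P]

lemma moments_projSum {U V : Ω → ℝ × ℝ} (hU : HasLaw U (planarGaussian (1 / 2)) P)
    (hV : HasLaw V (planarGaussian (1 / 2)) P) (h : IndepFun U V P) :
    MemLp (fun ω ↦ projSum (U ω) (V ω)) 2 P ∧
      ∫ ω, projSum (U ω) (V ω) ∂P = √Real.pi / (2 * √2) ∧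
      variance (fun ω ↦ projSum (U ω) (V ω)) P = (6 - Real.pi) / 8 := by
  have hS : HasLaw (fun ω ↦ U ω + V ω) (planarGaussian 1) P := by
    simpa only [add_halves] using hasLaw_add hU hV h
  have hD : HasLaw (fun ω ↦ U ω - V ω) (planarGaussian 1) P := by
    simpa only [add_halves, sub_eq_add_neg] using hasLaw_add hU (hasLaw_neg hV) (h.comp measurable_id measurable_neg)
  have hSD := indepFun_add_sub hU hV h
  set S := fun ω ↦ U ω + V ω with S_def
  set D := fun ω ↦ U ω - V ω with D_def
  set R := fun ω ↦ √((S ω).1 ^ 2 + (S ω).2 ^ 2) with R_def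
  set T := fun ω ↦ (direction (S ω)).1 * (D ω).1 + (direction (S ω)).2 * (D ω).2 with T_def
  have hT : HasLaw T (gaussianReal 0 1) P := by
    refine hasLaw_inner_direction hD (measurable_direction.comp_aemeasurable hS.aemeasurable) ?_
      (hSD.comp measurable_direction measurable_id)
    filter_upwards [ae_sq_add_sq_pos one_ne_zero hS] with ω hω using direction_sq_add_sq hω
  have hY : (fun ω ↦ projSum (U ω) (V ω)) = fun ω ↦ (R ω + T ω) / 2 := by
    ext ω; exact projSum_eq _ _
  have mR : MemLp R 2 P := by
    have := memLp_norm_planarGaussian 1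
    rw [← hS.map_eq] at this
    exact this.comp_of_map hS.aemeasurable
  have mT : MemLp T 2 P := hT.hasGaussianLaw.memLp_two
  have m1 {W : Ω → ℝ × ℝ} (hW : HasLaw W (planarGaussian 1) P) :
      HasLaw (fun ω ↦ (W ω).1) (gaussianReal 0 1) P := measurePreserving_fst.comp_hasLaw hW
  have m2 {W : Ω → ℝ × ℝ} (hW : HasLaw W (planarGaussian 1) P) :
      HasLaw (fun ω ↦ (W ω).2) (gaussianReal 0 1) P := measurePreserving_snd.comp_hasLaw hW
  have z {X : Ω → ℝ} (hX : HasLaw X (gaussianReal 0 1) P) : ∫ ω, X ω ∂P = 0 := by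
    rw [hX.integral_eq, integral_id_gaussianReal]
  have ER : ∫ ω, R ω ∂P = √(Real.pi / 2) := by
    rw [← integral_norm_planarGaussian]
    exact hS.integral_comp (f := fun p : ℝ × ℝ ↦ √(p.1 ^ 2 + p.2 ^ 2)) (by fun_prop)
  have ER2 : ∫ ω, R ω ^ 2 ∂P = 2 := by
    have : ∀ ω, R ω ^ 2 = (S ω).1 ^ 2 + (S ω).2 ^ 2 := fun ω ↦ Real.sq_sqrt (by positivity)
    simp_rw [this]
    rw [integral_add (m1 hS).hasGaussianLaw.memLp_two.integrable_sq
      (m2 hS).hasGaussianLaw.memLp_two.integrable_sq, integral_sq_of_hasLaw_gaussianReal (m1 hS),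
      integral_sq_of_hasLaw_gaussianReal (m2 hS)]
    norm_num
  -- Multiplying by `R` cancels the normalisation of the direction: `R T = ⟨S, D⟩`, with independent
  -- centred factors in each coordinate.
  have ERT : ∫ ω, R ω * T ω ∂P = 0 := by
    have : ∀ ω, R ω * T ω = (S ω).1 * (D ω).1 + (S ω).2 * (D ω).2 := by
      intro ω
      obtain ⟨h1, h2⟩ := direction_mul_norm (S ω)
      simp only [R_def, T_def]
      rw [mul_add, ← mul_assoc, ← mul_assoc, h1, h2]
    simp_rw [this]
    have i1 : IndepFun (fun ω ↦ (S ω).1) (fun ω ↦ (D ω).1) P :=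
      hSD.comp measurable_fst measurable_fst
    have i2 : IndepFun (fun ω ↦ (S ω).2) (fun ω ↦ (D ω).2) P :=
      hSD.comp measurable_snd measurable_snd
    have j1 : Integrable (fun ω ↦ (S ω).1 * (D ω).1) P :=
      (m1 hS).hasGaussianLaw.memLp_two.integrable_mul (m1 hD).hasGaussianLaw.memLp_two
    have j2 : Integrable (fun ω ↦ (S ω).2 * (D ω).2) P :=
      (m2 hS).hasGaussianLaw.memLp_two.integrable_mul (m2 hD).hasGaussianLaw.memLp_two
    rw [integral_add j1 j2,
      i1.integral_fun_mul_eq_mul_integral (m1 hS).aemeasurable.aestronglyMeasurable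
        (m1 hD).aemeasurable.aestronglyMeasurable,
      i2.integral_fun_mul_eq_mul_integral (m2 hS).aemeasurable.aestronglyMeasurable
        (m2 hD).aemeasurable.aestronglyMeasurable, z (m1 hS), z (m2 hS)]
    simp
  have mY : MemLp (fun ω ↦ projSum (U ω) (V ω)) 2 P := by
    rw [hY]
    simpa [div_eq_mul_inv] using! (mR.add mT).mul_const (2⁻¹ : ℝ)
  have EY : ∫ ω, projSum (U ω) (V ω) ∂P = √Real.pi / (2 * √2) := by
    rw [hY, integral_div, integral_add (mR.integrable (by norm_num)) (mT.integrable (by norm_num)),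
      ER, z hT, Real.sqrt_div Real.pi_pos.le]
    field_simp
    simp
  refine ⟨mY, EY, ?_⟩
  have EY2 : ∫ ω, projSum (U ω) (V ω) ^ 2 ∂P = 3 / 4 := by
    have : ∀ ω, projSum (U ω) (V ω) ^ 2 = (R ω ^ 2 + 2 * (R ω * T ω) + T ω ^ 2) / 4 := by
      intro ω
      rw [show projSum (U ω) (V ω) = (R ω + T ω) / 2 from projSum_eq _ _]
      ring
    simp_rw [this]
    have iRT : Integrable (fun ω ↦ 2 * (R ω * T ω)) P := (mR.integrable_mul mT).const_mul 2
    have iR : Integrable (fun ω ↦ R ω ^ 2 + 2 * (R ω * T ω)) P := mR.integrable_sq.add iRT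
    rw [integral_div, integral_add iR mT.integrable_sq,
      integral_add mR.integrable_sq iRT, integral_const_mul, ER2, ERT,
      integral_sq_of_hasLaw_gaussianReal hT]
    norm_num
  rw [variance_eq_sub mY, EY]
  simp only [Pi.pow_apply]
  rw [EY2, div_pow, mul_pow, Real.sq_sqrt Real.pi_pos.le, Real.sq_sqrt (by norm_num)]
  ring

/-- The component of `W` along the direction of `U + V`. -/
lemma hasLaw_component {U V W : Ω → ℝ × ℝ} (hU : HasLaw U (planarGaussian (1 / 2)) P)
    (hV : HasLaw V (planarGaussian (1 / 2)) P) (hW : HasLaw W (planarGaussian (1 / 2)) P)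
    (hUV : IndepFun U V P) (h : IndepFun (fun ω ↦ (U ω, V ω)) W P) :
    HasLaw (fun ω ↦ (direction (U ω + V ω)).1 * (W ω).1 + (direction (U ω + V ω)).2 * (W ω).2)
      (gaussianReal 0 (1 / 2)) P := by
  have hS := hasLaw_add hU hV hUV
  refine hasLaw_inner_direction (Θ := fun ω ↦ direction (U ω + V ω)) hW
    (measurable_direction.comp_aemeasurable hS.aemeasurable) ?_
    (h.comp (φ := fun q : (ℝ × ℝ) × (ℝ × ℝ) ↦ direction (q.1 + q.2)) (by fun_prop) measurable_id)
  filter_upwards [ae_sq_add_sq_pos (by norm_num) hS] with ω hω using direction_sq_add_sq hω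

end RIS

/-! ### Independence of blocks and the central limit theorem for arrays. -/

namespace RIS

/-- Independence means that the joint law is a product; currying turns the product over `ι × κ` into
a product over `ι` of products over `κ`. -/
lemma iIndepFun_curry {Ω ι κ 𝓧 : Type*} [MeasurableSpace Ω] [MeasurableSpace 𝓧] {P : Measure Ω}
    {X : ι → κ → Ω → 𝓧} (mX : ∀ i j, Measurable (X i j))
    (h : iIndepFun (fun (p : ι × κ) ω ↦ X p.1 p.2 ω) P) :
    iIndepFun (fun i ω j ↦ X i j ω) P := by
  have := h.isProbabilityMeasure
  have (i : ι) (j : κ) : IsProbabilityMeasure (P.map (X i j)) :=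
    Measure.isProbabilityMeasure_map (mX i j).aemeasurable
  have hrow (i : ι) : iIndepFun (X i) P :=
    h.precomp (g := fun j ↦ (i, j)) (Prod.mk_right_injective i)
  rw [iIndepFun_iff_map_fun_eq_infinitePi_map (by fun_prop)]
  simp_rw [fun i ↦ (hrow i).map_fun_eq_infinitePi_map (mX i)]
  have hall := h.map_fun_eq_infinitePi_map (fun p : ι × κ ↦ mX p.1 p.2)
  rw [← Measure.infinitePi_map_curry (fun i j ↦ P.map (X i j)), ← hall,
    Measure.map_map (by fun_prop) (by fun_prop)]
  rfl

open scoped Topology in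
open Asymptotics in
/-- If `φ` agrees with `1 - t ^ 2 / 2` to second order at `0`, and `n * (s n) ^ 2 → 1`, then
`φ (s n * t) ^ n → exp (- t ^ 2 / 2)`. -/
lemma tendsto_pow_exp_neg_sq_half {φ : ℝ → ℂ}
    (hφ : (fun t : ℝ ↦ φ t - (1 - (t : ℂ) ^ 2 / 2)) =o[𝓝 0] fun t : ℝ ↦ t ^ 2)
    {s : ℕ → ℝ} (hs0 : Tendsto s atTop (𝓝 0))
    (hs : Tendsto (fun n : ℕ ↦ n * s n ^ 2) atTop (𝓝 1)) (t : ℝ) :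
    Tendsto (fun n : ℕ ↦ φ (s n * t) ^ n) atTop (𝓝 (Complex.exp (-(t : ℂ) ^ 2 / 2))) := by
  -- It suffices that `φ (s n * t) = 1 - t²/(2n) + o(1/n)`. The error splits into the Taylor
  -- remainder (`h1`) and the cost of replacing `s n ^ 2` by `1/n` (`h2`).
  apply Complex.tendsto_pow_exp_of_isLittleO_sub_add_div
  have hinv : (fun n : ℕ ↦ (1 / (n : ℂ))) =Θ[atTop] fun n : ℕ ↦ (1 / (n : ℝ)) := by
    refine IsTheta.of_norm_eventuallyEq_norm (Eventually.of_forall fun n ↦ ?_)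
    simp
  have hst : Tendsto (fun n ↦ s n * t) atTop (𝓝 0) := by simpa using hs0.mul_const t
  have hsq : (fun n ↦ (s n * t) ^ 2) =O[atTop] fun n : ℕ ↦ (1 / (n : ℝ)) := by
    have h1 : (fun n : ℕ ↦ (n * s n ^ 2) * (t ^ 2 * (1 / (n : ℝ)))) =O[atTop]
        fun n : ℕ ↦ (1 : ℝ) * (1 / (n : ℝ)) :=
      (hs.isBigO_one ℝ).mul ((isBigO_refl _ _).const_mul_left _)
    simp only [one_mul] at h1
    refine h1.congr' ?_ (EventuallyEq.refl _ _)
    filter_upwards [eventually_gt_atTop 0] with n hn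
    field_simp
  have h1 : (fun n ↦ φ (s n * t) - (1 - ((s n * t : ℝ) : ℂ) ^ 2 / 2)) =o[atTop]
      fun n : ℕ ↦ (1 / (n : ℂ)) :=
    ((hφ.comp_tendsto hst).trans_isBigO hsq).trans_isTheta hinv.symm
  have h2 : (fun n : ℕ ↦ (((t ^ 2 / 2) * ((1 - n * s n ^ 2) * (1 / n)) : ℝ) : ℂ)) =o[atTop]
      fun n : ℕ ↦ (1 / (n : ℂ)) := by
    have h0 : (fun n : ℕ ↦ 1 - n * s n ^ 2) =o[atTop] fun _ : ℕ ↦ (1 : ℝ) :=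
      (isLittleO_one_iff ℝ).2 (by simpa using hs.const_sub 1)
    have h3 := (h0.mul_isBigO (isBigO_refl (fun n : ℕ ↦ (1 / (n : ℝ))) atTop)).const_mul_left
      (t ^ 2 / 2)
    simp only [one_mul] at h3
    refine IsLittleO.trans_isTheta ?_ hinv.symm
    refine (IsTheta.isBigO ?_).trans_isLittleO h3
    exact IsTheta.of_norm_eventuallyEq_norm
      (Eventually.of_forall fun n ↦ Complex.norm_real _)
  refine (h1.add h2).congr' ?_ (EventuallyEq.refl _ _)
  filter_upwards [eventually_gt_atTop 0] with n hn
  have : (n : ℂ) ≠ 0 := by exact_mod_cast hn.ne'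
  push_cast
  field_simp
  ring

open scoped Topology in
/-- Central limit theorem for row-wise i.i.d. triangular arrays with a common law, perturbed by an
independent centred Gaussian term whose variance does not depend on the row. -/
theorem tendstoInDistribution_sum_add_gaussian {Ω : ℕ → Type*} [∀ N, MeasurableSpace (Ω N)]
    {P : (N : ℕ) → Measure (Ω N)} [∀ N, IsProbabilityMeasure (P N)]
    {Y : (N : ℕ) → Fin N → Ω N → ℝ} {W : (N : ℕ) → Ω N → ℝ} {ν : Measure ℝ} {τ : ℝ≥0} {a v c : ℝ}
    [IsProbabilityMeasure ν] (hY : ∀ N i, HasLaw (Y N i) ν (P N))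
    (hYi : ∀ N, iIndepFun (Y N) (P N))
    (hW : ∀ N, HasLaw (W N) (gaussianReal 0 τ) (P N))
    (hYW : ∀ N, IndepFun (fun ω ↦ ∑ i, Y N i ω) (W N) (P N))
    (hν : MemLp id 2 ν) (ha : ∫ x, x ∂ν = a) (hv : variance id ν = v) (hv0 : 0 < v) (hc : 0 < c)
    (hτ : 0 < τ) :
    TendstoInDistribution
      (fun N ω ↦ (c * ∑ i, Y N i ω + W N ω - N * (c * a)) / √(N * (c ^ 2 * v) + τ))
      atTop (id : ℝ → ℝ) P (gaussianReal 0 1) where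
  forall_aemeasurable N := by
    have := fun i ↦ (hY N i).aemeasurable
    have := (hW N).aemeasurable
    fun_prop
  tendsto := by
    refine ProbabilityMeasure.tendsto_iff_tendsto_charFun.2 fun t ↦ ?_
    simp only [ProbabilityMeasure.coe_mk, Measure.map_id]
    have hsv : 0 < √v := Real.sqrt_pos.2 hv0
    -- Standardising under `ν` makes the second-order Taylor expansion of the characteristic
    -- function available.
    set g : ℝ → ℝ := fun x ↦ (x - a) / √v with hg
    have hg0 : ∫ x, g x ∂ν = 0 := by
      have hint : Integrable (fun x : ℝ ↦ x) ν := hν.integrable (by norm_num)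
      simp only [hg]
      rw [integral_div, integral_sub hint (integrable_const _)]
      simp [ha]
    have hg1 : ∫ x, g x ^ 2 ∂ν = 1 := by
      simp only [hg, div_pow]
      rw [integral_div, Real.sq_sqrt hv0.le, ← hv, variance_eq_integral aemeasurable_id]
      simp only [id, ha]
      refine div_self ?_
      have := variance_eq_integral (μ := ν) aemeasurable_id
      simp only [id, ha] at this
      rw [← this]
      exact (hv.trans_gt hv0).ne'
    have hφ := taylor_charFun_two (P := ν) (X := g) (by fun_prop) hg0 hg1
    set σ : ℕ → ℝ := fun N ↦ √(N * (c ^ 2 * v) + τ) with hσ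
    have hτ' : (0 : ℝ) < τ := hτ
    have hK : 0 < c ^ 2 * v := by positivity
    -- Positivity of `τ` covers `N = 0` as well.
    have hσpos (N : ℕ) : 0 < σ N := Real.sqrt_pos.2 (by positivity)
    have hσsq (N : ℕ) : σ N ^ 2 = N * (c ^ 2 * v) + τ := Real.sq_sqrt (by positivity)
    have hlin : Tendsto (fun N : ℕ ↦ N * (c ^ 2 * v) + (τ : ℝ)) atTop atTop :=
      tendsto_atTop_add_const_right _ _ (tendsto_natCast_atTop_atTop.atTop_mul_const hK)
    have hσtop : Tendsto σ atTop atTop := Real.tendsto_sqrt_atTop.comp hlin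
    have hr : Tendsto (fun N ↦ (σ N)⁻¹) atTop (𝓝 0) := tendsto_inv_atTop_zero.comp hσtop
    have hs0 : Tendsto (fun N ↦ c * √v * (σ N)⁻¹) atTop (𝓝 0) := by
      simpa using hr.const_mul (c * √v)
    have hs1 : Tendsto (fun N : ℕ ↦ N * (c * √v * (σ N)⁻¹) ^ 2) atTop (𝓝 1) := by
      -- `N c² v / σ_N² = 1 - τ / σ_N²`.
      have h1 : Tendsto (fun N : ℕ ↦ 1 - τ * (N * (c ^ 2 * v) + (τ : ℝ))⁻¹) atTop (𝓝 1) := by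
        simpa using ((tendsto_inv_atTop_zero.comp hlin).const_mul (τ : ℝ)).const_sub 1
      refine h1.congr fun N ↦ ?_
      have : (N : ℝ) * (c ^ 2 * v) + τ ≠ 0 := by positivity
      rw [mul_pow, mul_pow, inv_pow, hσsq, Real.sq_sqrt hv0.le]
      field_simp
      ring
    have hpow := tendsto_pow_exp_neg_sq_half hφ hs0 hs1 t
    have hgauss : Tendsto (fun N ↦ charFun (gaussianReal 0 τ) ((σ N)⁻¹ * t)) atTop (𝓝 1) := by
      have hcont : Continuous (charFun (gaussianReal 0 τ)) := continuous_charFun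
      have : Tendsto (fun N ↦ (σ N)⁻¹ * t) atTop (𝓝 0) := by simpa using hr.mul_const t
      simpa [Function.comp_def] using (hcont.tendsto 0).comp this
    -- Independence factors the characteristic function into `N` equal factors and a noise factor
    -- that tends to `1`.
    have key (N : ℕ) : charFun ((P N).map
          fun ω ↦ (c * ∑ i, Y N i ω + W N ω - N * (c * a)) / √(N * (c ^ 2 * v) + τ)) t
        = charFun (ν.map g) (c * √v * (σ N)⁻¹ * t) ^ N
          * charFun (gaussianReal 0 τ) ((σ N)⁻¹ * t) := by
      have mY := fun i ↦ (hY N i).aemeasurable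
      have mW := (hW N).aemeasurable
      have mgY (i : Fin N) : AEMeasurable (fun ω ↦ g (Y N i ω)) (P N) := by fun_prop
      have hlaw (i : Fin N) : (P N).map (fun ω ↦ g (Y N i ω)) = ν.map g := by
        rw [← (hY N i).map_eq, AEMeasurable.map_map_of_aemeasurable (by fun_prop) (mY i)]
        rfl
      have hsum (ω : Ω N) : ∑ i, g (Y N i ω) = (∑ i, Y N i ω - N * a) / √v := by
        simp [hg, ← Finset.sum_div, Finset.sum_sub_distrib]
      have hrep : (fun ω ↦ (c * ∑ i, Y N i ω + W N ω - N * (c * a)) / √(N * (c ^ 2 * v) + τ))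
          = fun ω ↦ c * √v * (σ N)⁻¹ * ∑ i, g (Y N i ω) + (σ N)⁻¹ * W N ω := by
        ext ω
        have := (hσpos N).ne'
        rw [hsum, ← show σ N = √(N * (c ^ 2 * v) + τ) from rfl]
        field_simp
        ring
      have hind : IndepFun (fun ω ↦ c * √v * (σ N)⁻¹ * ∑ i, g (Y N i ω))
          (fun ω ↦ (σ N)⁻¹ * W N ω) (P N) := by
        simp_rw [hsum]
        exact (hYW N).comp (φ := fun x ↦ c * √v * (σ N)⁻¹ * ((x - N * a) / √v))
          (ψ := fun x ↦ (σ N)⁻¹ * x) (by fun_prop) (by fun_prop)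
      rw [hrep, hind.charFun_map_fun_add_eq_mul (by fun_prop) (by fun_prop), Pi.mul_apply,
        charFun_map_mul_comp (by fun_prop), charFun_map_mul_comp (by fun_prop), (hW N).map_eq,
        ((hYi N).comp (fun _ ↦ g) (fun _ ↦ by fun_prop)).charFun_map_fun_sum_eq_prod mgY]
      simp only [hlaw, Finset.prod_apply]
      simp
    simp_rw [key]
    simpa [charFun_gaussianReal, neg_div] using hpow.mul hgauss

end RIS

/-! ### Application to the channel model. -/

namespace RIS

variable {Ω : Type*} [MeasurableSpace Ω] {P : Measure Ω}

/-- Moments of a scaled sum of independent variables plus an independent centred term. -/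
lemma moments_const_mul_sum_add [IsProbabilityMeasure P] {N : ℕ} {Y : Fin N → Ω → ℝ} {W : Ω → ℝ}
    {a v τ : ℝ} (c : ℝ) (hY : ∀ i, MemLp (Y i) 2 P) (ha : ∀ i, ∫ ω, Y i ω ∂P = a)
    (hv : ∀ i, variance (Y i) P = v) (hYi : iIndepFun Y P) (hW : MemLp W 2 P)
    (hW0 : ∫ ω, W ω ∂P = 0) (hWv : variance W P = τ)
    (hYW : IndepFun (fun ω ↦ ∑ i, Y i ω) W P) :
    MemLp (fun ω ↦ c * ∑ i, Y i ω + W ω) 2 P ∧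
      ∫ ω, (c * ∑ i, Y i ω + W ω) ∂P = N * (c * a) ∧
      variance (fun ω ↦ c * ∑ i, Y i ω + W ω) P = N * (c ^ 2 * v) + τ := by
  have mS : MemLp (fun ω ↦ ∑ i, Y i ω) 2 P := memLp_finsetSum _ fun i _ ↦ hY i
  have mcS : MemLp (fun ω ↦ c * ∑ i, Y i ω) 2 P := mS.const_mul c
  refine ⟨mcS.add hW, ?_, ?_⟩
  · rw [integral_add (mcS.integrable (by norm_num)) (hW.integrable (by norm_num)),
      integral_const_mul, integral_finsetSum _ fun i _ ↦ (hY i).integrable (by norm_num), hW0]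
    simp only [ha, Finset.sum_const, Finset.card_univ, Fintype.card_fin, nsmul_eq_mul]
    ring
  · have hind : IndepFun (fun ω ↦ c * ∑ i, Y i ω) W P :=
      hYW.comp (φ := fun x ↦ c * x) (by fun_prop) measurable_id
    have hsum : variance (fun ω ↦ ∑ i, Y i ω) P = N * v := by
      have := IndepFun.variance_sum (s := Finset.univ) (fun i _ ↦ hY i)
        fun i _ j _ hij ↦ hYi.indepFun hij
      rw [show (∑ i, Y i) = fun ω ↦ ∑ i, Y i ω from by ext; simp] at this
      rw [this]
      simp [hv]
    rw [hind.variance_fun_add mcS hW, variance_const_mul, hsum, hWv]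
    ring

section Realization

variable {Nr N : ℕ}

/-- The numerator of `Y_i` is `⟨U, U + V⟩`. -/
lemma elemY_eq_projSum (H : Fin Nr → Fin N → ℂ) (m n : Fin Nr) (i : Fin N) :
    elemY H m n i = projSum ((H m i).re, -(H m i).im) ((H n i).im, (H n i).re) := by
  simp only [elemY, coefA, coefB, coefC, coefD, projSum, direction, Prod.fst_add, Prod.snd_add]
  ring

/-- With `λ₁ = 1/2` the factor `1/2` occurs in both numerator and modulus and cancels, leaving the
direction of `U + V`. -/
lemma elemYhat_eq (H : Fin Nr → Fin N → ℂ) (m n mhat : Fin Nr) (i : Fin N) :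
    elemYhat H m n mhat i =
      (direction (((H m i).re, -(H m i).im) + ((H n i).im, (H n i).re))).1 * (H mhat i).re
      + (direction (((H m i).re, -(H m i).im) + ((H n i).im, (H n i).re))).2
        * -(H mhat i).im := by
  have h : phaseModulus (1 / 2) H m n i =
      √((coefA H m i + coefB H n i) ^ 2 + (coefC H m i + coefD H n i) ^ 2) / 2 := by
    rw [phaseModulus, show (1 / 2 * coefA H m i + (1 - 1 / 2) * coefB H n i) ^ 2
      + (1 / 2 * coefC H m i + (1 - 1 / 2) * coefD H n i) ^ 2
      = ((coefA H m i + coefB H n i) ^ 2 + (coefC H m i + coefD H n i) ^ 2) / 2 ^ 2 by ring,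
      Real.sqrt_div (by positivity), Real.sqrt_sq (by norm_num)]
  have half (x y r : ℝ) : (1 / 2 * x + (1 - 1 / 2) * y) / (r / 2) = (x + y) / r := by
    rw [show 1 / 2 * x + (1 - 1 / 2) * y = (x + y) / 2 by ring,
      div_div_div_cancel_right₀ (by norm_num)]
  rw [elemYhat, thetaRe, thetaIm, h, half, half]
  simp only [coefA, coefB, coefC, coefD, direction, Prod.fst_add, Prod.snd_add]
  ring

lemma measurable_elemY (m n : Fin Nr) (i : Fin N) :
    Measurable fun H : Fin Nr → Fin N → ℂ ↦ elemY H m n i := by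
  unfold elemY coefA coefB coefC coefD
  fun_prop

lemma measurable_elemYhat (m n mhat : Fin Nr) (i : Fin N) :
    Measurable fun H : Fin Nr → Fin N → ℂ ↦ elemYhat H m n mhat i := by
  unfold elemYhat thetaRe thetaIm phaseModulus coefA coefB coefC coefD
  fun_prop

end Realization

@[fun_prop]
lemma measurable_projSum : Measurable fun q : (ℝ × ℝ) × (ℝ × ℝ) ↦ projSum q.1 q.2 := by
  unfold projSum; fun_prop

/-- The common law of the variables `Y_i`. -/
noncomputable def elemYLaw : Measure ℝ :=
  ((planarGaussian (1 / 2)).prod (planarGaussian (1 / 2))).map fun q ↦ projSum q.1 q.2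

instance : IsProbabilityMeasure elemYLaw := Measure.isProbabilityMeasure_map (by fun_prop)

namespace IsChannelModel

variable {Nr N : ℕ} {H : Ω → Fin Nr → Fin N → ℂ} {w : Ω → Fin Nr → ℂ} {N0 : ℝ}

lemma measurable_entry (h : IsChannelModel P H w N0) (l : Fin Nr) (i : Fin N) :
    Measurable fun ω ↦ H ω l i :=
  (measurable_pi_apply i).comp ((measurable_pi_apply l).comp h.measurable_channel)

lemma indepFun_vectors (h : IsChannelModel P H w N0) {m n : Fin Nr} (hmn : m ≠ n) (i : Fin N) :
    IndepFun (fun ω ↦ ((H ω m i).re, -(H ω m i).im)) (fun ω ↦ ((H ω n i).im, (H ω n i).re)) P :=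
  (h.channel_indep.indepFun (i := (m, i)) (j := (n, i)) (by simpa using hmn)).comp
    (φ := fun z : ℂ ↦ (z.re, -z.im)) (ψ := fun z : ℂ ↦ (z.im, z.re)) (by fun_prop) (by fun_prop)

lemma iIndepFun_columns (h : IsChannelModel P H w N0) :
    iIndepFun (fun i ω l ↦ H ω l i) P :=
  iIndepFun_curry (X := fun i l ω ↦ H ω l i) (fun i l ↦ h.measurable_entry l i)
    (h.channel_indep.precomp (g := Prod.swap) Prod.swap_injective)

lemma hasLaw_noise (h : IsChannelModel P H w N0) (l : Fin Nr) :
    HasLaw (fun ω ↦ (w ω l).re) (gaussianReal 0 (N0.toNNReal / 2)) P :=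
  hasLaw_re (h.noise_law l)

lemma iIndepFun_elemY (h : IsChannelModel P H w N0) (m n : Fin Nr) :
    iIndepFun (fun i ω ↦ elemY (H ω) m n i) P := by
  -- `Y_i` depends only on column `i`, so it is one fixed function of that column: `elemY` for a
  -- surface with a single element.
  have hmeas : Measurable fun z : Fin Nr → ℂ ↦ elemY (fun l (_ : Fin 1) ↦ z l) m n 0 :=
    (measurable_elemY m n 0).comp (by fun_prop)
  exact h.iIndepFun_columns.comp (fun _ z ↦ elemY (fun l (_ : Fin 1) ↦ z l) m n 0) fun _ ↦ hmeas

lemma iIndepFun_elemYhat (h : IsChannelModel P H w N0) (m n mhat : Fin Nr) :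
    iIndepFun (fun i ω ↦ elemYhat (H ω) m n mhat i) P := by
  have hmeas : Measurable fun z : Fin Nr → ℂ ↦ elemYhat (fun l (_ : Fin 1) ↦ z l) m n mhat 0 :=
    (measurable_elemYhat m n mhat 0).comp (by fun_prop)
  exact h.iIndepFun_columns.comp (fun _ z ↦ elemYhat (fun l (_ : Fin 1) ↦ z l) m n mhat 0)
    fun _ ↦ hmeas

lemma indepFun_sum_elemY_noise (h : IsChannelModel P H w N0) (m n l : Fin Nr) :
    IndepFun (fun ω ↦ ∑ i, elemY (H ω) m n i) (fun ω ↦ (w ω l).re) P :=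
  h.noise_indep.comp (φ := fun K ↦ ∑ i, elemY K m n i) (ψ := fun z : Fin Nr → ℂ ↦ (z l).re)
    (Finset.measurable_fun_sum _ fun i _ ↦ measurable_elemY m n i) (by fun_prop)

lemma indepFun_sum_elemYhat_noise (h : IsChannelModel P H w N0) (m n mhat l : Fin Nr) :
    IndepFun (fun ω ↦ ∑ i, elemYhat (H ω) m n mhat i) (fun ω ↦ (w ω l).re) P :=
  h.noise_indep.comp (φ := fun K ↦ ∑ i, elemYhat K m n mhat i) (ψ := fun z : Fin Nr → ℂ ↦ (z l).re)
    (Finset.measurable_fun_sum _ fun i _ ↦ measurable_elemYhat m n mhat i) (by fun_prop)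

lemma moments_noise (h : IsChannelModel P H w N0) (hN0 : 0 ≤ N0) (l : Fin Nr) :
    MemLp (fun ω ↦ (w ω l).re) 2 P ∧ ∫ ω, (w ω l).re ∂P = 0 ∧
      variance (fun ω ↦ (w ω l).re) P = N0 / 2 := by
  have hl := h.hasLaw_noise l
  refine ⟨hl.hasGaussianLaw.memLp_two, ?_, ?_⟩
  · rw [hl.integral_eq, integral_id_gaussianReal]
  · rw [hl.variance_eq, variance_id_gaussianReal]
    simp [hN0]

variable [IsProbabilityMeasure P]

/-- Provides the law, free of `N`, `i` and the probability space, that the central limit theorem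
requires. -/
lemma hasLaw_elemY (h : IsChannelModel P H w N0) {m n : Fin Nr} (hmn : m ≠ n) (i : Fin N) :
    HasLaw (fun ω ↦ elemY (H ω) m n i) elemYLaw P := by
  simp_rw [elemY_eq_projSum]
  exact HasLaw.comp (Y := fun q : (ℝ × ℝ) × (ℝ × ℝ) ↦ projSum q.1 q.2) ⟨by fun_prop, rfl⟩
    ((indepFun_iff_hasLaw_prodMk_prod (hasLaw_re_neg_im (h.channel_law m i))
      (hasLaw_im_re (h.channel_law n i))).1 (h.indepFun_vectors hmn i))

lemma moments_elemY (h : IsChannelModel P H w N0) {m n : Fin Nr} (hmn : m ≠ n) (i : Fin N) :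
    MemLp (fun ω ↦ elemY (H ω) m n i) 2 P ∧
      ∫ ω, elemY (H ω) m n i ∂P = √Real.pi / (2 * √2) ∧
      variance (fun ω ↦ elemY (H ω) m n i) P = (6 - Real.pi) / 8 := by
  simp_rw [elemY_eq_projSum]
  exact moments_projSum (hasLaw_re_neg_im (h.channel_law m i))
      (hasLaw_im_re (h.channel_law n i)) (h.indepFun_vectors hmn i)

lemma hasLaw_elemYhat (h : IsChannelModel P H w N0) {m n mhat : Fin Nr} (hmn : m ≠ n)
    (hhat_n : mhat ≠ n) (hhat_m : mhat ≠ m) (i : Fin N) :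
    HasLaw (fun ω ↦ elemYhat (H ω) m n mhat i) (gaussianReal 0 (1 / 2)) P := by
  simp_rw [elemYhat_eq]
  -- Independence from the pair needs `mhat` to differ from both `m` and `n`.
  have hind := h.channel_indep.indepFun_prodMk (fun p ↦ h.measurable_entry p.1 p.2)
    (m, i) (n, i) (mhat, i) (by simpa using hhat_m.symm) (by simpa using hhat_n.symm)
  exact hasLaw_component (hasLaw_re_neg_im (h.channel_law m i))
    (hasLaw_im_re (h.channel_law n i)) (hasLaw_re_neg_im (h.channel_law mhat i))
    (h.indepFun_vectors hmn i)
    (hind.comp (φ := fun q : ℂ × ℂ ↦ ((q.1.re, -q.1.im), (q.2.im, q.2.re)))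
      (ψ := fun z : ℂ ↦ (z.re, -z.im)) (by fun_prop) (by fun_prop))

lemma moments_statZ1 (h : IsChannelModel P H w N0) (hN0 : 0 ≤ N0) {Es : ℝ} (hEs : 0 ≤ Es)
    {m n : Fin Nr} (hmn : m ≠ n) :
    MemLp (fun ω ↦ statZ1 Es (H ω) (w ω) m n) 2 P ∧
      ∫ ω, statZ1 Es (H ω) (w ω) m n ∂P = N * √(Real.pi * Es) / (2 * √2) ∧
      variance (fun ω ↦ statZ1 Es (H ω) (w ω) m n) P
        = N * (6 - Real.pi) * Es / 8 + N0 / 2 := by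
  obtain ⟨hW, hW0, hWv⟩ := h.moments_noise hN0 m
  obtain ⟨h1, h2, h3⟩ := moments_const_mul_sum_add (√Es) (fun i ↦ (h.moments_elemY hmn i).1)
    (fun i ↦ (h.moments_elemY hmn i).2.1) (fun i ↦ (h.moments_elemY hmn i).2.2)
    (h.iIndepFun_elemY m n) hW hW0 hWv (h.indepFun_sum_elemY_noise m n m)
  refine ⟨h1, h2.trans ?_, h3.trans ?_⟩
  · rw [Real.sqrt_mul Real.pi_pos.le]; ring
  · rw [Real.sq_sqrt hEs]; ring

lemma hasLaw_statZ2 (h : IsChannelModel P H w N0) (hN0 : 0 ≤ N0) {Es : ℝ} (hEs : 0 ≤ Es)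
    {m n mhat : Fin Nr} (hmn : m ≠ n) (hhat_n : mhat ≠ n) (hhat_m : mhat ≠ m) :
    HasLaw (fun ω ↦ statZ2 Es (H ω) (w ω) m n mhat)
      (gaussianReal 0 (N * Es / 2 + N0 / 2).toNNReal) P := by
  have hl := h.hasLaw_elemYhat hmn hhat_n hhat_m
  have hlW := h.hasLaw_noise mhat
  obtain ⟨hW, hW0, hWv⟩ := h.moments_noise hN0 mhat
  have hind : IndepFun (fun ω ↦ √Es • ∑ i, elemYhat (H ω) m n mhat i)
      (fun ω ↦ (w ω mhat).re) P :=
    (h.indepFun_sum_elemYhat_noise m n mhat mhat).comp (φ := fun x ↦ √Es • x) (by fun_prop)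
      measurable_id
  have hsum : HasGaussianLaw (fun ω ↦ ∑ i, elemYhat (H ω) m n mhat i) P :=
    iIndepFun.hasGaussianLaw_fun_sum (fun i ↦ (hl i).hasGaussianLaw)
      (h.iIndepFun_elemYhat m n mhat)
  have hG : HasGaussianLaw (fun ω ↦ statZ2 Es (H ω) (w ω) m n mhat) P :=
    iIndepFun.hasGaussianLaw_fun_add (hsum.fun_smul (√Es)) hlW.hasGaussianLaw hind
  obtain ⟨-, h2, h3⟩ := moments_const_mul_sum_add (v := 1 / 2) (√Es)
    (fun i ↦ (hl i).hasGaussianLaw.memLp_two)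
    (fun i ↦ by rw [(hl i).integral_eq, integral_id_gaussianReal])
    (fun i ↦ by rw [(hl i).variance_eq, variance_id_gaussianReal]; simp)
    (h.iIndepFun_elemYhat m n mhat) hW hW0 hWv (h.indepFun_sum_elemYhat_noise m n mhat mhat)
  -- A real Gaussian law is determined by its mean and variance, which `h2` and `h3` supply.
  refine ⟨hG.aemeasurable, hG.map_eq_gaussianReal.trans ?_⟩
  congr 1
  · exact h2.trans (by ring)
  · congr 1
    refine h3.trans ?_
    rw [Real.sq_sqrt hEs]; ring

end IsChannelModel

end RIS

theorem theorem1 {Nr : ℕ} (m n mhat : Fin Nr) (hmn : m ≠ n) (hhat_n : mhat ≠ n)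
    (hhat_m : mhat ≠ m) (Es N0 : ℝ) (hEs : 0 < Es) (hN0 : 0 < N0)
    {Ω : ℕ → Type*} [∀ N, MeasurableSpace (Ω N)]
    (P : (N : ℕ) → Measure (Ω N)) [∀ N, IsProbabilityMeasure (P N)]
    (H : (N : ℕ) → Ω N → Fin Nr → Fin N → ℂ) (w : (N : ℕ) → Ω N → Fin Nr → ℂ)
    (hmodel : ∀ N, RIS.IsChannelModel (P N) (H N) (w N) N0) :
    -- per-element moments, for every number `N` of reflecting elements
    (∀ (N : ℕ) (i : Fin N),
      MemLp (fun ω ↦ RIS.elemY (H N ω) m n i) 2 (P N) ∧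
      ∫ ω, RIS.elemY (H N ω) m n i ∂(P N) = √Real.pi / (2 * √2) ∧
      variance (fun ω ↦ RIS.elemY (H N ω) m n i) (P N) = (6 - Real.pi) / 8 ∧
      MemLp (fun ω ↦ RIS.elemYhat (H N ω) m n mhat i) 2 (P N) ∧
      ∫ ω, RIS.elemYhat (H N ω) m n mhat i ∂(P N) = 0 ∧
      variance (fun ω ↦ RIS.elemYhat (H N ω) m n mhat i) (P N) = 1 / 2) ∧
    -- exact mean and variance of `Z₁`, for every `N`
    (∀ N : ℕ,
      MemLp (fun ω ↦ RIS.statZ1 Es (H N ω) (w N ω) m n) 2 (P N) ∧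
      ∫ ω, RIS.statZ1 Es (H N ω) (w N ω) m n ∂(P N) = N * √(Real.pi * Es) / (2 * √2) ∧
      variance (fun ω ↦ RIS.statZ1 Es (H N ω) (w N ω) m n) (P N)
        = N * (6 - Real.pi) * Es / 8 + N0 / 2) ∧
    -- asymptotic normality of `Z₁` with these parameters, as `N → ∞`
    TendstoInDistribution
      (fun (N : ℕ) ω ↦
        (RIS.statZ1 Es (H N ω) (w N ω) m n - N * √(Real.pi * Es) / (2 * √2))
          / √(N * (6 - Real.pi) * Es / 8 + N0 / 2))
      atTop (id : ℝ → ℝ) P (gaussianReal 0 1) ∧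
    -- exact normality of `Z₂`, for every `N`
    (∀ N : ℕ,
      HasLaw (fun ω ↦ RIS.statZ2 Es (H N ω) (w N ω) m n mhat)
        (gaussianReal 0 (N * Es / 2 + N0 / 2).toNNReal) (P N)) := by
  refine ⟨fun N i ↦ ?_, fun N ↦ (hmodel N).moments_statZ1 hN0.le hEs.le hmn, ?_,
    fun N ↦ (hmodel N).hasLaw_statZ2 hN0.le hEs.le hmn hhat_n hhat_m⟩
  · obtain ⟨h1, h2, h3⟩ := (hmodel N).moments_elemY hmn i
    have hl := (hmodel N).hasLaw_elemYhat hmn hhat_n hhat_m i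
    refine ⟨h1, h2, h3, hl.hasGaussianLaw.memLp_two, ?_, ?_⟩
    · rw [hl.integral_eq, integral_id_gaussianReal]
    · rw [hl.variance_eq, variance_id_gaussianReal]
      simp
  -- The moments of `elemYLaw` are read off from the one-element system, the smallest with an
  -- element to use.
  · obtain ⟨h1, h2, h3⟩ := (hmodel 1).moments_elemY hmn 0
    have hl := (hmodel 1).hasLaw_elemY hmn 0
    have hmem : MemLp id 2 RIS.elemYLaw := by
      rw [← hl.map_eq]
      exact (memLp_map_measure_iff aestronglyMeasurable_id hl.aemeasurable).2 h1
    have hτ : 0 < N0.toNNReal / 2 := by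
      have := Real.toNNReal_pos.2 hN0
      positivity
    have hclt := RIS.tendstoInDistribution_sum_add_gaussian
      (fun N i ↦ (hmodel N).hasLaw_elemY hmn i) (fun N ↦ (hmodel N).iIndepFun_elemY m n)
      (fun N ↦ (hmodel N).hasLaw_noise m) (fun N ↦ (hmodel N).indepFun_sum_elemY_noise m n m)
      hmem (hl.integral_eq.symm.trans h2) (hl.variance_eq.symm.trans h3)
      (by linarith [Real.pi_lt_four]) (Real.sqrt_pos.2 hEs) hτ
    convert hclt using 3 with N
    have hmean : N * √(Real.pi * Es) / (2 * √2) = N * (√Es * (√Real.pi / (2 * √2))) := by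
      rw [Real.sqrt_mul Real.pi_pos.le]; ring
    have hvar : N * (6 - Real.pi) * Es / 8 + N0 / 2
        = N * (√Es ^ 2 * ((6 - Real.pi) / 8)) + (N0.toNNReal / 2 : ℝ≥0) := by
      rw [Real.sq_sqrt hEs.le]
      push_cast
      rw [Real.coe_toNNReal _ hN0.le]
      ring
    rw [hmean, hvar, RIS.statZ1]
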